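/- Consider single-pass streaming stochastic bandits. An instance is $\nu=(\mu_1,\dots,\mu_n)\in[0,1]^n$; pulling arm $i$ gives an independent $\mathrm{Ber}(\mu_i)$ reward. Put $\Delta_i(\nu)=\max_j\mu_j-\mu_i$. The arms arrive in the order $1,\dots,n$. An algorithm with memory $m$ starts with empty memory. In each round $t=1,\dots,T$ it first discards any number of arms from memory and reads any number of further arms from the stream (an arm that was discarded, or was passed over without being stored, never becomes available again), keeping at most $m$ arms in memory; then it pulls one arm $A_t$ in memory and observes the reward. Its decisions may be randomized and may depend on $T$, on all other parameters, and on the entire history of moves and rewards. Its expected regret on $\nu$ is $\mathbb E_\nu[R(T)]=\mathbb E_\nu\big[\sum_{t=1}^T\Delta_{A_t}(\nu)\big]$. There is an absolute constant $c>0$ such that the following holds. Let $\alpha\ge 1$ be real, let $m,n$ be integers with $2\le m<n$, and let $T$ be sufficiently large (depending only on $\alpha,m,n$). Then there is a finite set $H$ of instances with $n$ arms, each having at least one arm with $\Delta_i>0$, such that for every algorithm with memory $m$ there is $\nu\in H$ with $$\mathbb E_\nu[R(T)]\ \ge\ c\cdot 16^{-\alpha}\cdot\frac{T^{\frac1{\alpha+1}}}{m^{\frac1{\alpha+1}}}\sum_{i:\Delta_i(\nu)>0}\Delta_i(\nu)^{1-2\alpha}\qquad\text{if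 } m<\tfrac23 n,$$ $$\mathbb E_\nu[R(T)]\ \ge\ c\cdot 16^{-\alpha}\cdot\frac{(n-m)\,T^{\frac1{\alpha+1}}}{n^{1+\frac1{\alpha+1}}}\sum_{i:\Delta_i(\nu)>0}\Delta_i(\nu)^{1-2\alpha}\qquad\text{if } m\ge\tfrac23 n.$$ If $m\ge\frac23n$, every instance in $H$ moreover has a unique best arm. -/

import Mathlib

noncomputable section

/-- A bandit instance with `n` arms: the `i`-th arm of the stream has reward law `Ber (ν i)`. -/
abbrev BanditInstance (n : ℕ) : Type := Fin n → unitInterval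

namespace BanditInstance

variable {n : ℕ}

/-- The largest reward mean. -/
def bestMean (ν : BanditInstance n) : ℝ := ⨆ i, (ν i : ℝ)

/-- The gap `Δ i` between the largest mean and the mean of arm `i`. -/
def gap (ν : BanditInstance n) (i : Fin n) : ℝ := ν.bestMean - ν i

/-- The sum of `Δ i ^ (1 - 2 * α)` over the arms with `0 < Δ i`. -/
def gapSum (ν : BanditInstance n) (α : ℝ) : ℝ :=
  ∑ i with 0 < ν.gap i, ν.gap i ^ (1 - 2 * α)

/-- Exactly one arm attains the largest mean. -/
def HasUniqueBestArm (ν : BanditInstance n) : Prop := ∃! i, (ν i : ℝ) = ν.bestMean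

/-- The reward law `Ber (ν i)` of arm `i`, where `true` stands for reward `1`. -/
def rewardProb (ν : BanditInstance n) (i : Fin n) : Bool → ℝ
  | true => ν i
  | false => 1 - ν i

end BanditInstance

/-- What the player does in one round: after the memory has been rearranged, `pos` is the number of
arms of the stream that have been read so far (these are the arms with index `< pos`), `mem` is the
set of arms in memory, and `arm` is the arm that is pulled. -/
structure StreamAction (n : ℕ) where
  pos : Fin (n + 1)
  mem : Finset (Fin n)
  arm : Fin n

instance (n : ℕ) : Fintype (StreamAction n) :=
  Fintype.ofEquiv (Fin (n + 1) × Finset (Fin n) × Fin n)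
    { toFun := fun x => ⟨x.1, x.2.1, x.2.2⟩
      invFun := fun a => (a.pos, a.mem, a.arm)
      left_inv := fun _ => rfl
      right_inv := fun _ => rfl }

/-- A round: the action of the player and the reward that is observed. -/
abbrev StreamRound (n : ℕ) : Type := StreamAction n × Bool

/-- A history: the list of the rounds played so far, the most recent one first. -/
abbrev StreamHistory (n : ℕ) : Type := List (StreamRound n)

namespace StreamHistory

variable {n : ℕ}

/-- The number of arms that have been read from the stream. -/
def pos : StreamHistory n → ℕ
  | [] => 0
  | r :: _ => r.1.pos

/-- The arms that are in memory. -/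
def mem : StreamHistory n → Finset (Fin n)
  | [] => ∅
  | r :: _ => r.1.mem

/-- The moves allowed in a single pass with memory `m`. The stream is only read forwards; an arm of
the new memory was in memory before or is read from the stream in this round, so that a discarded or
skipped arm never comes back; at most `m` arms are stored; the pulled arm is in memory. -/
structure IsLegalMove (m : ℕ) (h : StreamHistory n) (a : StreamAction n) : Prop where
  pos_le : pos h ≤ a.pos
  mem_sub : ∀ i ∈ a.mem, i ∈ mem h ∨ (pos h ≤ i ∧ (i : ℕ) < a.pos)
  card_le : a.mem.card ≤ m
  arm_mem : a.arm ∈ a.mem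

/-- All moves of the history were allowed. -/
def IsLegal (m : ℕ) : StreamHistory n → Prop
  | [] => True
  | r :: h => IsLegal m h ∧ IsLegalMove m h r.1

end StreamHistory

/-- A (randomized) single-pass streaming algorithm for `n` arms with memory `m`: given the history,
it draws an allowed move from a distribution. -/
structure StreamingAlgorithm (n m : ℕ) where
  act : StreamHistory n → PMF (StreamAction n)
  legal : ∀ h, StreamHistory.IsLegal m h →
    ∀ a ∈ (act h).support, StreamHistory.IsLegalMove m h a

namespace StreamingAlgorithm

variable {n m : ℕ}

/-- The probability that the algorithm, run on the instance `ν`, produces the history `h` in its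
first `h.length` rounds. -/
def historyProb (A : StreamingAlgorithm n m) (ν : BanditInstance n) : StreamHistory n → ℝ
  | [] => 1
  | r :: h => A.historyProb ν h * (A.act h r.1).toReal * ν.rewardProb r.1.arm r.2

/-- The expectation of the sum of the gaps of the arms pulled in the rounds `1, …, T`. -/
def expectedRegret (A : StreamingAlgorithm n m) (ν : BanditInstance n) (T : ℕ) : ℝ :=
  ∑ h : List.Vector (StreamRound n) T,
    A.historyProb ν h.toList * (h.toList.map fun r => ν.gap r.1.arm).sum

end StreamingAlgorithm

end

/-! Cut the early arms into `B` blocks of length `s ≥ m`. On `lastBest` every arm except the last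
has gap at least `1/4`, so an algorithm with small regret there pulls the blocks rarely, and soon
pulls arms beyond any given block. By pigeonhole some block receives few pulls. When an arm beyond
that block is first pulled, memory holds at most `m - 1` of its `s` arms, so at least `s + 1 - m` of
them are lost for good.

Now raise one arm `i` of that block by `ε` and make all later blocks worthless (`blockBest`). The
two instances agree up to the end of the block except at `i`, so a change of measure stopped at the
first later pull costs only about `ε²` per pull of `i` (`half_expect_lost_sub_le`). Averaged over
the block, some `i` is still lost with probability at least `(s + 1 - m) / (8 * s)`. In that case
each of the remaining `T / 2` or more rounds costs at least `ε` (`exists_le_expectedRegret`).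

It remains to compare with `gapSum`, which is at most of order `n * 16 ^ α` on `lastBest` and `s * ε
^ (1 - 2 * α)` on `blockBest`. Taking `ε² = 1 / (16 * N)` with `N ^ (α + 1) = T / M` balances the
two alternatives. -/

noncomputable section

open Finset

namespace BanditInstance

variable {n : ℕ} (ν : BanditInstance n)

theorem rewardProb_nonneg (i : Fin n) (x : Bool) : 0 ≤ ν.rewardProb i x := by
  cases x
  · exact sub_nonneg.2 (ν i).2.2
  · exact (ν i).2.1

theorem sum_rewardProb (i : Fin n) : ∑ x, ν.rewardProb i x = 1 := by
  simp [rewardProb]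

theorem le_bestMean (i : Fin n) : (ν i : ℝ) ≤ ν.bestMean :=
  le_ciSup (f := fun i => (ν i : ℝ)) (Set.finite_range _).bddAbove i

theorem gap_nonneg (i : Fin n) : 0 ≤ ν.gap i := sub_nonneg.2 (ν.le_bestMean i)

variable {ν} in
theorem bestMean_eq {i : Fin n} (h : ∀ j, (ν j : ℝ) ≤ ν i) : ν.bestMean = ν i := by
  have : Nonempty (Fin n) := ⟨i⟩
  exact le_antisymm (ciSup_le h) (ν.le_bestMean i)

end BanditInstance

/-! ### Histories: passing an index, losing an arm, stopped functions. -/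

namespace StreamHistory

variable {n : ℕ}

/-- The sum of the gaps of the arms pulled in the history. -/
def regret (ν : BanditInstance n) (h : StreamHistory n) : ℝ :=
  (h.map fun r => ν.gap r.1.arm).sum

/-- The number of pulls of arm `i`. -/
def pulls (i : Fin n) : StreamHistory n → ℝ
  | [] => 0
  | r :: h => pulls i h + if r.1.arm = i then 1 else 0

/-- Some arm with index at least `e` has been pulled. -/
def Passed (e : ℕ) (h : StreamHistory n) : Prop := ∃ r ∈ h, e ≤ (r.1.arm : ℕ)

/-- Arm `i` was not in memory when an arm with index at least `e` was pulled for the first time. -/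
def Lost (e : ℕ) (i : Fin n) : StreamHistory n → Prop
  | [] => False
  | r :: h => Lost e i h ∨ (¬ Passed e h ∧ e ≤ (r.1.arm : ℕ) ∧ i ∉ r.1.mem)

open Classical in
/-- The logarithm of the likelihood ratio of `ν'` and `ν` for the rewards of arm `i` that are
observed before an arm with index at least `e` is pulled. -/
def logRatio (ν ν' : BanditInstance n) (e : ℕ) (i : Fin n) : StreamHistory n → ℝ
  | [] => 0
  | r :: h => logRatio ν ν' e i h + if ¬ Passed e h ∧ r.1.arm = i then
      Real.log (ν'.rewardProb i r.2) - Real.log (ν.rewardProb i r.2) else 0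

/-- A function of the history that is determined by the moves up to the first pull of an arm with
index at least `e` and by the rewards before that pull. -/
structure IsStoppedAt (e : ℕ) (f : StreamHistory n → ℝ) : Prop where
  eq_of_passed : ∀ r h, Passed e h → f (r :: h) = f h
  reward_irrelevant : ∀ a x y h, e ≤ (a.arm : ℕ) → f ((a, x) :: h) = f ((a, y) :: h)

theorem passed_cons {e : ℕ} {r : StreamRound n} {h : StreamHistory n} :
    Passed e (r :: h) ↔ e ≤ (r.1.arm : ℕ) ∨ Passed e h := by
  simp [Passed]

theorem not_passed_nil {e : ℕ} : ¬ Passed e ([] : StreamHistory n) := by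
  simp [Passed]

theorem lost_cons_of_passed {e : ℕ} {i : Fin n} {r : StreamRound n} {h : StreamHistory n}
    (hp : Passed e h) : Lost e i (r :: h) ↔ Lost e i h := by
  simp [Lost, hp]

theorem regret_cons (ν : BanditInstance n) (r : StreamRound n) (h : StreamHistory n) :
    regret ν (r :: h) = ν.gap r.1.arm + regret ν h := by
  simp [regret]

theorem regret_nonneg (ν : BanditInstance n) (h : StreamHistory n) : 0 ≤ regret ν h := by
  apply List.sum_nonneg
  simp only [List.mem_map]
  rintro _ ⟨r, -, rfl⟩
  exact ν.gap_nonneg _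

theorem IsLegal.lt_pos {m : ℕ} {h : StreamHistory n} (hl : IsLegal m h) {i : Fin n}
    (hi : i ∈ mem h) : (i : ℕ) < pos h := by
  induction h with
  | nil => simp [mem] at hi
  | cons r h ih =>
    rcases hl.2.mem_sub i hi with h' | h'
    · exact (ih hl.1 h').trans_le hl.2.pos_le
    · exact h'.2

/-- A lost arm never becomes available again. -/
theorem IsLegal.not_mem_of_lost {m e : ℕ} {h : StreamHistory n} (hl : IsLegal m h) {i : Fin n}
    (hie : (i : ℕ) < e) (hi : Lost e i h) : i ∉ mem h ∧ (i : ℕ) < pos h := by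
  induction h with
  | nil => exact hi.elim
  | cons r h ih =>
    rcases hi with h' | h'
    · obtain ⟨h1, h2⟩ := ih hl.1 h'
      refine ⟨fun hm => ?_, h2.trans_le hl.2.pos_le⟩
      rcases hl.2.mem_sub i hm with h3 | h3
      · exact h1 h3
      · omega
    · exact ⟨h'.2.2, hie.trans (h'.2.1.trans_lt (hl.lt_pos hl.2.arm_mem))⟩

open Classical in
/-- When an arm beyond `e` is pulled for the first time, at most `m - 1` of the earlier arms are in
memory. -/
theorem IsLegal.card_le_card_lost {m e : ℕ} {h : StreamHistory n} (hl : IsLegal m h)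
    {S : Finset (Fin n)} (hS : ∀ i ∈ S, (i : ℕ) < e) (hp : Passed e h) :
    #S + 1 ≤ #{i ∈ S | Lost e i h} + m := by
  induction h with
  | nil => exact (not_passed_nil hp).elim
  | cons r h ih =>
    by_cases hph : Passed e h
    · simpa only [lost_cons_of_passed hph] using ih hl.1 hph
    · have he : e ≤ (r.1.arm : ℕ) := (passed_cons.1 hp).resolve_right hph
      have h1 : S \ r.1.mem ⊆ {i ∈ S | Lost e i (r :: h)} := fun i hi => by
        rw [mem_sdiff] at hi
        exact mem_filter.2 ⟨hi.1, .inr ⟨hph, he, hi.2⟩⟩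
      -- The pulled arm lies beyond `e`, hence outside `S`, and occupies one of the `m` places; this
      -- is the source of the `+ 1`.
      have h2 : S ∩ r.1.mem ⊆ r.1.mem.erase r.1.arm := fun i hi => by
        rw [mem_inter] at hi
        refine mem_erase.2 ⟨fun h' => ?_, hi.2⟩
        have := hS i hi.1
        rw [h'] at this
        omega
      have h3 := card_le_card h1
      have h4 := card_le_card h2
      rw [card_erase_of_mem hl.2.arm_mem] at h4
      have h5 := card_sdiff_add_card_inter S r.1.mem
      have h6 := hl.2.card_le
      have h7 := card_pos.2 ⟨_, hl.2.arm_mem⟩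
      omega

open Classical in
theorem isStoppedAt_lost (e : ℕ) (i : Fin n) :
    IsStoppedAt e (fun h => if Lost e i h then 1 else 0) where
  eq_of_passed r h hp := by simp only [lost_cons_of_passed hp]
  reward_irrelevant a x y h _ := if_congr Iff.rfl rfl rfl

theorem isStoppedAt_const (e : ℕ) (c : ℝ) : IsStoppedAt e (fun _ : StreamHistory n => c) where
  eq_of_passed _ _ _ := rfl
  reward_irrelevant _ _ _ _ _ := rfl

end StreamHistory

/-! ### Expectations over histories, computed round by round. -/

namespace StreamingAlgorithm

open StreamHistory

variable {n m : ℕ} (A : StreamingAlgorithm n m) (ν : BanditInstance n)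

/-- The expectation of `f` after one more round, given the history. -/
def next (f : StreamHistory n → ℝ) (h : StreamHistory n) : ℝ :=
  ∑ a, (A.act h a).toReal * ∑ x, ν.rewardProb a.arm x * f ((a, x) :: h)

/-- The expectation of `f` over the histories of the first `t` rounds. -/
def expect : ℕ → (StreamHistory n → ℝ) → ℝ
  | 0, f => f []
  | t + 1, f => expect t (A.next ν f)

theorem sum_historyProb (t : ℕ) (f : StreamHistory n → ℝ) :
    ∑ h : List.Vector (StreamRound n) t, A.historyProb ν h.toList * f h.toList
      = A.expect ν t f := by
  induction t generalizing f with
  | zero =>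
    rw [Fintype.sum_eq_single List.Vector.nil fun v hv => (hv (List.Vector.eq_nil v)).elim]
    simp [historyProb, expect]
  | succ t ih =>
    rw [expect, ← ih]
    let φ : List.Vector (StreamRound n) (t + 1) ≃
        List.Vector (StreamRound n) t × StreamRound n :=
      { toFun := fun v => (v.tail, v.head)
        invFun := fun p => p.2 ::ᵥ p.1
        left_inv := fun v => List.Vector.cons_head_tail v
        right_inv := fun p => by simp }
    rw [← φ.symm.sum_comp, Fintype.sum_prod_type]
    refine Fintype.sum_congr _ _ fun v => ?_
    rw [next, mul_sum, Fintype.sum_prod_type]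
    refine Fintype.sum_congr _ _ fun a => ?_
    rw [mul_sum, mul_sum]
    refine Fintype.sum_congr _ _ fun x => ?_
    simp only [φ, Equiv.coe_fn_symm_mk, List.Vector.toList_cons, historyProb]
    ring

theorem expectedRegret_eq (T : ℕ) : A.expectedRegret ν T = A.expect ν T (regret ν) :=
  A.sum_historyProb ν T (regret ν)

theorem sum_act (h : StreamHistory n) : ∑ a, (A.act h a).toReal = 1 := by
  rw [← ENNReal.toReal_sum fun a _ => (A.act h).apply_ne_top a, ← tsum_fintype (L := .unconditional _),
    (A.act h).tsum_coe, ENNReal.toReal_one]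

variable {A ν}

/-- Illegal moves have weight zero after a legal history, so estimates under the expectation need
only be checked on legal moves. -/
theorem act_mul_le_act_mul {h : StreamHistory n} (hl : IsLegal m h) {a : StreamAction n}
    {x y : ℝ} (hxy : IsLegalMove m h a → x ≤ y) :
    (A.act h a).toReal * x ≤ (A.act h a).toReal * y := by
  by_cases ha : a ∈ (A.act h).support
  · exact mul_le_mul_of_nonneg_left (hxy (A.legal h hl a ha)) ENNReal.toReal_nonneg
  · have : A.act h a = 0 := by simpa [PMF.mem_support_iff] using ha
    simp [this]

theorem next_le {f : StreamHistory n → ℝ} {h : StreamHistory n} {c : ℝ} (hl : IsLegal m h)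
    (hf : ∀ a, IsLegalMove m h a → ∑ x, ν.rewardProb a.arm x * f ((a, x) :: h) ≤ c) :
    A.next ν f h ≤ c := by
  calc A.next ν f h ≤ ∑ a, (A.act h a).toReal * c :=
        sum_le_sum fun a _ => act_mul_le_act_mul hl (hf a)
    _ = c := by rw [← sum_mul, A.sum_act, one_mul]

theorem le_next {f : StreamHistory n → ℝ} {h : StreamHistory n} {c : ℝ} (hl : IsLegal m h)
    (hf : ∀ a, IsLegalMove m h a → c ≤ ∑ x, ν.rewardProb a.arm x * f ((a, x) :: h)) :
    c ≤ A.next ν f h := by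
  calc c = ∑ a, (A.act h a).toReal * c := by rw [← sum_mul, A.sum_act, one_mul]
    _ ≤ A.next ν f h := sum_le_sum fun a _ => act_mul_le_act_mul hl (hf a)

theorem next_eq_of_forall {f : StreamHistory n → ℝ} {h : StreamHistory n} {c : ℝ}
    (hf : ∀ r, f (r :: h) = c) : A.next ν f h = c := by
  simp only [next, hf, ← sum_mul, ν.sum_rewardProb, A.sum_act, one_mul]

theorem le_next_of_forall {f : StreamHistory n → ℝ} {h : StreamHistory n} {c : ℝ}
    (hl : IsLegal m h) (hf : ∀ r, IsLegalMove m h r.1 → c ≤ f (r :: h)) : c ≤ A.next ν f h :=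
  le_next hl fun a ha => by
    calc c = ∑ x, ν.rewardProb a.arm x * c := by rw [← sum_mul, ν.sum_rewardProb, one_mul]
      _ ≤ _ := sum_le_sum fun x _ =>
        mul_le_mul_of_nonneg_left (hf (a, x) ha) (ν.rewardProb_nonneg _ _)

theorem expect_mono {t : ℕ} {f g : StreamHistory n → ℝ}
    (hfg : ∀ h, h.length = t → IsLegal m h → f h ≤ g h) : A.expect ν t f ≤ A.expect ν t g := by
  induction t generalizing f g with
  | zero => exact hfg [] rfl trivial
  | succ t ih =>
    refine ih fun h ht hl => sum_le_sum fun a _ => act_mul_le_act_mul hl fun ha => ?_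
    refine sum_le_sum fun x _ => mul_le_mul_of_nonneg_left ?_ (ν.rewardProb_nonneg _ _)
    exact hfg _ (by simp [ht]) ⟨hl, ha⟩

theorem expect_const (t : ℕ) (c : ℝ) : A.expect ν t (fun _ => c) = c := by
  induction t with
  | zero => rfl
  | succ t ih =>
    rw [expect, show A.next ν (fun _ => c) = fun _ => c from
      funext fun h => next_eq_of_forall fun _ => rfl, ih]

theorem expect_add (t : ℕ) (f g : StreamHistory n → ℝ) :
    A.expect ν t (fun h => f h + g h) = A.expect ν t f + A.expect ν t g := by
  simp only [← sum_historyProb, mul_add, sum_add_distrib]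

theorem expect_const_mul (t : ℕ) (c : ℝ) (f : StreamHistory n → ℝ) :
    A.expect ν t (fun h => c * f h) = c * A.expect ν t f := by
  simp only [← sum_historyProb, mul_sum, mul_left_comm]

theorem expect_sum {ι : Type*} (t : ℕ) (s : Finset ι) (f : ι → StreamHistory n → ℝ) :
    A.expect ν t (fun h => ∑ i ∈ s, f i h) = ∑ i ∈ s, A.expect ν t (f i) := by
  simp only [← sum_historyProb, mul_sum]
  rw [sum_comm]

theorem expect_nonneg {t : ℕ} {f : StreamHistory n → ℝ} (hf : ∀ h, 0 ≤ f h) :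
    0 ≤ A.expect ν t f := by
  rw [← expect_const (A := A) (ν := ν) t 0]
  exact expect_mono fun h _ _ => hf h

theorem expect_le_expect_add {t : ℕ} (k : ℕ) {f : StreamHistory n → ℝ}
    (hf : ∀ r h, f h ≤ f (r :: h)) : A.expect ν t f ≤ A.expect ν (t + k) f := by
  induction k with
  | zero => rfl
  | succ k ih =>
    exact ih.trans (expect_mono fun h _ hl => le_next_of_forall hl fun r _ => hf r h)

theorem expect_regret_le {t T : ℕ} (h : t ≤ T) :
    A.expect ν t (regret ν) ≤ A.expectedRegret ν T := by
  obtain ⟨k, rfl⟩ := Nat.exists_eq_add_of_le h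
  rw [expectedRegret_eq]
  refine expect_le_expect_add k fun r h => ?_
  rw [regret_cons]
  linarith [ν.gap_nonneg r.1.arm]

open Classical in
/-- After the best arm has been lost, every round has regret at least `ε`. -/
theorem mul_expect_lost_le_expectedRegret {e : ℕ} {i : Fin n} (hi : (i : ℕ) < e) {ε : ℝ}
    (hε : 0 ≤ ε) (hgap : ∀ j, j ≠ i → ε ≤ ν.gap j) (t k : ℕ) :
    ε * k * A.expect ν t (fun h => if Lost e i h then 1 else 0) ≤ A.expectedRegret ν (t + k) := by
  rw [expectedRegret_eq]
  induction k with
  | zero => simpa using expect_nonneg (regret_nonneg ν)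
  | succ k ih =>
    set f : StreamHistory n → ℝ := fun h => if Lost e i h then 1 else 0 with hf
    have h1 : A.expect ν t f ≤ A.expect ν (t + k) f := expect_le_expect_add k fun r h => by
      by_cases h' : Lost e i h
      · simp [hf, h', show Lost e i (r :: h) from .inl h']
      · simp only [hf, h', if_false]; split_ifs <;> norm_num
    have h2 : A.expect ν (t + k) (regret ν) + ε * A.expect ν (t + k) f
        ≤ A.expect ν (t + (k + 1)) (regret ν) := by
      rw [← expect_const_mul, ← expect_add]
      refine expect_mono fun h _ hl => le_next_of_forall hl fun r hr => ?_
      rw [regret_cons]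
      by_cases h' : Lost e i h
      · have hne : r.1.arm ≠ i := fun heq =>
          (IsLegal.not_mem_of_lost (h := r :: h) ⟨hl, hr⟩ hi (.inl h')).1 (heq ▸ hr.arm_mem)
        simp only [hf, h', if_true]
        linarith [hgap _ hne]
      · simp only [hf, h', if_false]
        linarith [ν.gap_nonneg r.1.arm]
    have h3 := mul_le_mul_of_nonneg_left h1 hε
    push_cast
    linarith

/-! ### Change of measure up to the first pull beyond `e`. -/

section ChangeOfMeasure

variable {ν' : BanditInstance n} {e : ℕ} {i : Fin n}

theorem _root_.StreamHistory.IsStoppedAt.next_eq {f : StreamHistory n → ℝ} (hf : IsStoppedAt e f)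
    {h : StreamHistory n} (hp : Passed e h) : A.next ν f h = f h :=
  next_eq_of_forall fun r => hf.eq_of_passed r h hp

theorem _root_.StreamHistory.IsStoppedAt.next {f : StreamHistory n → ℝ} (hf : IsStoppedAt e f) :
    IsStoppedAt e (A.next ν f) where
  eq_of_passed r h hp := by
    rw [hf.next_eq hp, hf.next_eq (passed_cons.2 (.inr hp)), hf.eq_of_passed r h hp]
  reward_irrelevant a x y h ha := by
    rw [hf.next_eq (passed_cons.2 (.inl ha)), hf.next_eq (passed_cons.2 (.inl ha)),
      hf.reward_irrelevant a x y h ha]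

/-- Change of measure up to the first pull of an arm with index at least `e`. -/
theorem expect_exp_logRatio_mul (hν : ∀ j : Fin n, (j : ℕ) < e → j ≠ i → ν j = ν' j)
    (hpos : ∀ x, 0 < ν.rewardProb i x) (hpos' : ∀ x, 0 < ν'.rewardProb i x)
    {f : StreamHistory n → ℝ} (hf : IsStoppedAt e f) (t : ℕ) :
    A.expect ν t (fun h => Real.exp (logRatio ν ν' e i h) * f h) = A.expect ν' t f := by
  induction t generalizing f with
  | zero => simp [expect, logRatio]
  | succ t ih =>
    rw [expect, expect, ← ih hf.next]
    congr 1
    funext h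
    by_cases hp : Passed e h
    · rw [hf.next_eq hp]
      exact next_eq_of_forall fun r => by simp [logRatio, hp, hf.eq_of_passed r h hp]
    rw [next, next, mul_sum]
    refine Fintype.sum_congr _ _ fun a => ?_
    rw [mul_left_comm]
    congr 1
    rw [mul_sum]
    by_cases hai : a.arm = i
    · refine Fintype.sum_congr _ _ fun x => ?_
      simp only [logRatio, hp, hai, not_false_eq_true, and_self, if_true]
      rw [Real.exp_add, Real.exp_sub, Real.exp_log (hpos x), Real.exp_log (hpos' x)]
      have := (hpos x).ne'
      field_simp
    simp only [logRatio, hai, and_false, if_false, add_zero]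
    -- Before `e` the two reward laws agree. Beyond `e` they may differ, but `f` ignores that
    -- reward, so only their total mass `1` enters.
    by_cases hae : (a.arm : ℕ) < e
    · refine Fintype.sum_congr _ _ fun x => ?_
      have : ν.rewardProb a.arm x = ν'.rewardProb a.arm x := by
        cases x <;> simp [BanditInstance.rewardProb, hν a.arm hae hai]
      rw [this]
      ring
    · have h1 : ∀ x, f ((a, x) :: h) = f ((a, true) :: h) := fun x =>
        hf.reward_irrelevant a x true h (not_lt.1 hae)
      simp only [h1, ← sum_mul, ← mul_sum, ν.sum_rewardProb, ν'.sum_rewardProb]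
      ring

/-- The bound `log x ≤ x - 1` replaces relative entropy by the chi-square divergence `ε² / (p * (1 -
p))` with `p = b + ε`, and `p * (1 - p) ≥ 3 / 16 ≥ 1 / 6` on `[1/2, 3/4]`. -/
theorem klBernoulli_le {b ε : ℝ} (hb : 1 / 2 ≤ b) (hε : 0 ≤ ε) (hbε : b + ε ≤ 3 / 4) :
    b * (Real.log b - Real.log (b + ε)) + (1 - b) * (Real.log (1 - b) - Real.log (1 - (b + ε)))
      ≤ 6 * ε ^ 2 := by
  have h1 : 0 < b := by linarith
  have h2 : 0 < b + ε := by linarith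
  have h3 : 0 < 1 - b := by linarith
  have h4 : 0 < 1 - (b + ε) := by linarith
  have h5 := Real.log_le_sub_one_of_pos (div_pos h1 h2)
  have h6 := Real.log_le_sub_one_of_pos (div_pos h3 h4)
  rw [Real.log_div h1.ne' h2.ne'] at h5
  rw [Real.log_div h3.ne' h4.ne'] at h6
  have h7 : b * (b / (b + ε) - 1) + (1 - b) * ((1 - b) / (1 - (b + ε)) - 1)
      = ε ^ 2 / ((b + ε) * (1 - (b + ε))) := by
    field_simp
    ring
  have h8 : ε ^ 2 / ((b + ε) * (1 - (b + ε))) ≤ 6 * ε ^ 2 := by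
    rw [div_le_iff₀ (mul_pos h2 h4)]
    have h9 : 1 ≤ 6 * ((b + ε) * (1 - (b + ε))) := by nlinarith
    nlinarith [mul_le_mul_of_nonneg_left h9 (sq_nonneg ε)]
  nlinarith [mul_le_mul_of_nonneg_left h5 h1.le, mul_le_mul_of_nonneg_left h6 h3.le]

/-- Given the past, `-logRatio` grows on average by the relative entropy when `i` is pulled before
passage, and by nothing otherwise. Hence `-logRatio - 6 * ε ^ 2 * pulls i` is a supermartingale. -/
theorem expect_neg_logRatio_le {b ε : ℝ} (hb : 1 / 2 ≤ b) (hε : 0 ≤ ε) (hbε : b + ε ≤ 3 / 4)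
    (hνi : (ν i : ℝ) = b) (hνi' : (ν' i : ℝ) = b + ε) (t : ℕ) :
    A.expect ν t (fun h => -logRatio ν ν' e i h)
      ≤ A.expect ν t (fun h => 6 * ε ^ 2 * pulls i h) := by
  suffices H : A.expect ν t (fun h => -logRatio ν ν' e i h + -1 * (6 * ε ^ 2 * pulls i h)) ≤ 0 by
    rw [expect_add, expect_const_mul] at H
    linarith
  induction t with
  | zero => simp [expect, logRatio, pulls]
  | succ t ih =>
    rw [expect]
    refine le_trans (expect_mono fun h _ hl => next_le hl fun a _ => ?_) ih
    have hkl := klBernoulli_le hb hε hbε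
    have hs := ν.sum_rewardProb a.arm
    have h6 : 0 ≤ 6 * ε ^ 2 := by positivity
    rw [Fintype.sum_bool] at hs ⊢
    by_cases hai : a.arm = i
    · by_cases hp : Passed e h
      · simp only [logRatio, pulls, hai, hp, not_true_eq_false, false_and, if_true, if_false]
        rw [hai] at hs
        linear_combination (-logRatio ν ν' e i h - 6 * ε ^ 2 * (pulls i h + 1)) * hs + h6
      · simp only [logRatio, pulls, hai, hp, not_false_eq_true, and_self, if_true,
          BanditInstance.rewardProb, hνi, hνi']
        linear_combination hkl
    · simp only [logRatio, pulls, hai, and_false, if_false]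
      linear_combination (-logRatio ν ν' e i h - 6 * ε ^ 2 * pulls i h) * hs

open Classical in
theorem half_expect_lost_sub_le (hν : ∀ j : Fin n, (j : ℕ) < e → j ≠ i → ν j = ν' j)
    {b ε : ℝ} (hb : 1 / 2 ≤ b) (hε : 0 ≤ ε) (hbε : b + ε ≤ 3 / 4)
    (hνi : (ν i : ℝ) = b) (hνi' : (ν' i : ℝ) = b + ε) (t : ℕ) :
    1 / 2 * A.expect ν t (fun h => if Lost e i h then 1 else 0)
      - 6 * ε ^ 2 * A.expect ν t (pulls i)
      ≤ A.expect ν' t (fun h => if Lost e i h then 1 else 0) := by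
  have hpos : ∀ x, 0 < ν.rewardProb i x := by
    rintro (_ | _) <;> simp only [BanditInstance.rewardProb, hνi] <;> linarith
  have hpos' : ∀ x, 0 < ν'.rewardProb i x := by
    rintro (_ | _) <;> simp only [BanditInstance.rewardProb, hνi'] <;> linarith
  have h1 := expect_exp_logRatio_mul (A := A) hν hpos hpos' (isStoppedAt_lost e i) t
  have h2 := expect_exp_logRatio_mul (A := A) hν hpos hpos' (isStoppedAt_const e 1) t
  have h3 := expect_neg_logRatio_le (A := A) (e := e) hb hε hbε hνi hνi' t
  rw [expect_const] at h2
  rw [expect_const_mul] at h3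
  -- Pointwise, with `l` the log ratio: `e ^ l - l - 1 ≥ 0`, and `2 * e ^ l - l - 1 ≥ log 2 ≥ 1 / 2`
  -- when the arm is lost. In expectation `e ^ l` on the loss event gives the loss probability under
  -- `ν'`, and `e ^ l - l - 1` gives the relative entropy.
  have h4 : A.expect ν t (fun h => 1 / 2 * (if Lost e i h then 1 else 0)) ≤
      A.expect ν t (fun h => (Real.exp (logRatio ν ν' e i h) * (if Lost e i h then 1 else 0)
        + Real.exp (logRatio ν ν' e i h) * 1) + (-logRatio ν ν' e i h + -1)) := by
    refine expect_mono fun h _ _ => ?_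
    set l := logRatio ν ν' e i h
    have h5 := Real.add_one_le_exp l
    have h6 := Real.add_one_le_exp (l + Real.log 2)
    rw [Real.exp_add, Real.exp_log two_pos] at h6
    have h7 := Real.log_two_gt_d9
    split_ifs <;> linarith
  rw [expect_const_mul, expect_add, expect_add, expect_add, h1, h2, expect_const] at h4
  linarith

end ChangeOfMeasure

end StreamingAlgorithm

/-! ### Small regret forces losses when the early arms are bad. -/

namespace StreamHistory

variable {n : ℕ}

theorem sum_pulls_le_regret (ν : BanditInstance n) {U : Finset (Fin n)}
    (hU : ∀ i ∈ U, 1 / 4 ≤ ν.gap i) (h : StreamHistory n) :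
    ∑ i ∈ U, pulls i h ≤ 4 * regret ν h := by
  induction h with
  | nil => simp [pulls, regret]
  | cons r h ih =>
    simp only [pulls, sum_add_distrib, sum_ite_eq, regret_cons]
    split_ifs with hr
    · linarith [hU _ hr]
    · linarith [ν.gap_nonneg r.1.arm]

theorem length_le_regret_of_not_passed (ν : BanditInstance n) {e : ℕ}
    (hν : ∀ i : Fin n, (i : ℕ) < e → 1 / 4 ≤ ν.gap i) {h : StreamHistory n} (hp : ¬ Passed e h) :
    (h.length : ℝ) ≤ 4 * regret ν h := by
  induction h with
  | nil => simp [regret]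
  | cons r h ih =>
    rw [passed_cons, not_or, not_le] at hp
    rw [regret_cons, List.length_cons]
    push_cast
    linarith [ih hp.2, hν _ hp.1]

end StreamHistory

namespace StreamingAlgorithm

open StreamHistory

variable {n m : ℕ} {A : StreamingAlgorithm n m} {ν : BanditInstance n}

open Classical in
theorem sum_expect_lost_ge {e : ℕ} {S : Finset (Fin n)} (hS : ∀ i ∈ S, (i : ℕ) < e)
    (hν : ∀ i : Fin n, (i : ℕ) < e → 1 / 4 ≤ ν.gap i) (hm : m ≤ #S + 1) (t : ℕ) :
    ((#S : ℝ) + 1 - m) * (t - 4 * A.expect ν t (regret ν))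
      ≤ t * ∑ i ∈ S, A.expect ν t (fun h => if Lost e i h then 1 else 0) := by
  have hd : (0 : ℝ) ≤ (#S : ℝ) + 1 - m := by
    rw [sub_nonneg]; exact_mod_cast hm
  -- A history that has passed `e` has lost `#S + 1 - m` arms; one that has not has regret at least
  -- `t / 4`, which makes the left side nonpositive.
  have h1 : A.expect ν t (fun h => ((#S : ℝ) + 1 - m) * (t + -4 * regret ν h))
      ≤ A.expect ν t (fun h => t * ∑ i ∈ S, if Lost e i h then (1 : ℝ) else 0) := by
    refine expect_mono fun h ht hl => ?_
    by_cases hp : Passed e h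
    · have h2 : ((#S : ℝ) + 1) ≤ #{i ∈ S | Lost e i h} + m := by
        exact_mod_cast hl.card_le_card_lost hS hp
      rw [sum_boole]
      have h3 := regret_nonneg ν h
      have h4 : (0 : ℝ) ≤ t := t.cast_nonneg
      calc ((#S : ℝ) + 1 - m) * (t + -4 * regret ν h) ≤ ((#S : ℝ) + 1 - m) * t :=
            mul_le_mul_of_nonneg_left (by linarith) hd
        _ ≤ _ := by rw [mul_comm]; exact mul_le_mul_of_nonneg_left (by linarith) h4
    · have h2 := length_le_regret_of_not_passed ν hν hp
      rw [ht] at h2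
      exact (mul_nonpos_of_nonneg_of_nonpos hd (by linarith)).trans
        (mul_nonneg t.cast_nonneg (sum_nonneg fun i _ => by split_ifs <;> norm_num))
  rw [expect_const_mul, expect_add, expect_const, expect_const_mul, expect_const_mul,
    expect_sum] at h1
  linarith

/-- If the algorithm has small regret on `ν` and pulls the arms of `S` rarely, then it has large
regret on an instance where some arm of `S` is slightly improved. -/
theorem exists_le_expectedRegret {e : ℕ} {S : Finset (Fin n)} (hS : ∀ i ∈ S, (i : ℕ) < e)
    (hν : ∀ i : Fin n, (i : ℕ) < e → 1 / 4 ≤ ν.gap i) (hm : m ≤ #S) {ν' : Fin n → BanditInstance n}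
    (hνν' : ∀ i ∈ S, ∀ j : Fin n, (j : ℕ) < e → j ≠ i → ν j = ν' i j) {b ε : ℝ} (hb : 1 / 2 ≤ b)
    (hε : 0 ≤ ε) (hbε : b + ε ≤ 3 / 4) (hνi : ∀ i ∈ S, (ν i : ℝ) = b)
    (hνi' : ∀ i ∈ S, (ν' i i : ℝ) = b + ε) (hgap : ∀ i ∈ S, ∀ j, j ≠ i → ε ≤ (ν' i).gap j)
    {T : ℕ} (hT : 2 ≤ T) (hR : 24 * A.expectedRegret ν T ≤ T)
    (hpulls : 48 * ε ^ 2 * ∑ i ∈ S, A.expect ν (T / 2) (pulls i) ≤ (#S : ℝ) + 1 - m) :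
    ∃ i ∈ S, ε * T * ((#S : ℝ) + 1 - m) ≤ 16 * #S * A.expectedRegret (ν' i) T := by
  classical
  set t := T / 2
  have hd : (0 : ℝ) < (#S : ℝ) + 1 - m := by
    have : (m : ℝ) ≤ #S := by exact_mod_cast hm
    linarith
  -- Since `T ≤ 3 * t`, the assumption `24 * R ≤ T` yields `4 * R ≤ t / 2`.
  have ht3 : (T : ℝ) ≤ 3 * t := by exact_mod_cast (by omega : T ≤ 3 * (T / 2))
  have htT : t + (T - t) = T := by omega
  have hk : (T : ℝ) ≤ 2 * ((T - t : ℕ) : ℝ) := by exact_mod_cast (by omega : T ≤ 2 * (T - T / 2))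
  have ht0 : (0 : ℝ) < t := by
    have : (2 : ℝ) ≤ T := by exact_mod_cast hT
    linarith
  have h1 := sum_expect_lost_ge (A := A) hS hν (by omega) t
  have h2 := expect_regret_le (A := A) (ν := ν) (show t ≤ T by omega)
  have h3 : ((#S : ℝ) + 1 - m) / 2
      ≤ ∑ i ∈ S, A.expect ν t (fun h => if Lost e i h then 1 else 0) := by
    have h4 := mul_le_mul_of_nonneg_left
      (show (t : ℝ) / 2 ≤ t - 4 * A.expect ν t (regret ν) by linarith) hd.le
    exact le_of_mul_le_mul_left (by linarith) ht0
  -- Half of the previous bound is `1/4` of `#S + 1 - m`; `hpulls` limits the entropy loss to `1/8`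
  -- of it.
  have h5 : ((#S : ℝ) + 1 - m) / 8
      ≤ ∑ i ∈ S, A.expect (ν' i) t (fun h => if Lost e i h then 1 else 0) := by
    have h6 := sum_le_sum fun i hi => half_expect_lost_sub_le (A := A) (hνν' i hi) hb hε hbε
      (hνi i hi) (hνi' i hi) t
    rw [sum_sub_distrib, ← mul_sum, ← mul_sum] at h6
    linarith
  have hne : S.Nonempty := nonempty_of_sum_ne_zero (by linarith : (0 : ℝ) < _).ne'
  have hSpos : (0 : ℝ) < #S := by exact_mod_cast hne.card_pos
  obtain ⟨i, hi, h7⟩ := exists_le_of_sum_le hne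
    (f := fun _ => ((#S : ℝ) + 1 - m) / 8 / #S)
    (g := fun i => A.expect (ν' i) t (fun h => if Lost e i h then 1 else 0)) (by
      rw [sum_const, nsmul_eq_mul, mul_div_cancel₀ _ hSpos.ne']
      exact h5)
  refine ⟨i, hi, ?_⟩
  have h8 := mul_expect_lost_le_expectedRegret (A := A) (hS i hi) hε (hgap i hi) t (T - t)
  rw [htT] at h8
  rw [div_le_iff₀ hSpos] at h7
  have h9 : ε * T / 2 ≤ ε * ((T - t : ℕ) : ℝ) := by
    rw [mul_div_assoc]; exact mul_le_mul_of_nonneg_left (by linarith) hε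
  have h10 := mul_le_mul h9 h7 (by positivity) (by positivity)
  have h11 := mul_le_mul_of_nonneg_left h8 hSpos.le
  linarith

end StreamingAlgorithm

/-! ### The hard instances and their gap sums. -/

namespace BanditInstance

variable {n : ℕ}

/-- The mean of the arms in the block of arm `k`, when the arms are divided into blocks of
length `s`. -/
def blockMean (n s k : ℕ) : ℝ := 1 / 2 + (k / s : ℕ) / (8 * n)

theorem half_le_blockMean (n s k : ℕ) : 1 / 2 ≤ blockMean n s k := by
  unfold blockMean
  have : (0 : ℝ) ≤ (k / s : ℕ) / (8 * n) := by positivity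
  linarith

theorem blockMean_le {s k : ℕ} (hk : k < n) : blockMean n s k ≤ 5 / 8 := by
  unfold blockMean
  have h : ((k / s : ℕ) : ℝ) ≤ n := by exact_mod_cast (Nat.div_le_self k s).trans hk.le
  have hn0 : 0 < n := by omega
  have hn : (0 : ℝ) < 8 * n := by positivity
  have : ((k / s : ℕ) : ℝ) / (8 * n) ≤ 1 / 8 := by
    rw [div_le_iff₀ hn]; linarith
  linarith

/-- The instance whose last arm is the best one by a constant gap, while the means of the other arms
increase slightly from block to block. -/
def lastBest (n s : ℕ) : BanditInstance n := fun k =>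
  Set.projIcc 0 1 zero_le_one (if (k : ℕ) + 1 = n then 7 / 8 else blockMean n s k)

/-- The instance that agrees with `lastBest` in the blocks up to the one of arm `i`, except that
arm `i` is better by `ε`, and that has only arms of mean `0` in the later blocks. -/
def blockBest (s : ℕ) (ε : ℝ) (i : Fin n) : BanditInstance n := fun k =>
  Set.projIcc 0 1 zero_le_one
    (if k = i then blockMean n s k + ε
     else if (k : ℕ) / s ≤ i / s then blockMean n s k else 0)

theorem coe_lastBest (s : ℕ) (k : Fin n) :
    (lastBest n s k : ℝ) = if (k : ℕ) + 1 = n then 7 / 8 else blockMean n s k := by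
  have h1 := half_le_blockMean n s k
  have h2 := blockMean_le (s := s) k.2
  rw [lastBest, Set.projIcc_of_mem]
  split_ifs <;> constructor <;> linarith

theorem coe_blockBest (s : ℕ) {ε : ℝ} (hε : 0 ≤ ε) (hε' : ε ≤ 1 / 8) (i k : Fin n) :
    (blockBest s ε i k : ℝ) = if k = i then blockMean n s k + ε
      else if (k : ℕ) / s ≤ i / s then blockMean n s k else 0 := by
  have h1 := half_le_blockMean n s k
  have h2 := blockMean_le (s := s) k.2
  rw [blockBest, Set.projIcc_of_mem]
  split_ifs <;> constructor <;> linarith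

theorem gap_eq_of_forall_le {ν : BanditInstance n} {i : Fin n} (h : ∀ j, (ν j : ℝ) ≤ ν i)
    (j : Fin n) : ν.gap j = ν i - ν j := by
  rw [gap, bestMean_eq h]

theorem hasUniqueBestArm_of_lt {ν : BanditInstance n} {i : Fin n}
    (h : ∀ j, j ≠ i → (ν j : ℝ) < ν i) : ν.HasUniqueBestArm := by
  have hle : ∀ j, (ν j : ℝ) ≤ ν i := fun j => by
    by_cases hj : j = i
    · rw [hj]
    · exact (h j hj).le
  refine ⟨i, (bestMean_eq hle).symm, fun j hj => ?_⟩
  by_contra hne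
  exact (h j hne).ne (hj.trans (bestMean_eq hle))

theorem quarter_le_gap_lastBest (s : ℕ) {k : Fin n} (hk : (k : ℕ) + 1 ≠ n) :
    1 / 4 ≤ (lastBest n s).gap k := by
  have h := blockMean_le (s := s) k.2
  have h1 := (lastBest n s).le_bestMean ⟨n - 1, by omega⟩
  rw [coe_lastBest, if_pos (by simp only []; omega)] at h1
  rw [gap, coe_lastBest, if_neg hk]
  linarith

theorem hasUniqueBestArm_lastBest (s : ℕ) (hn : 0 < n) : (lastBest n s).HasUniqueBestArm := by
  refine hasUniqueBestArm_of_lt (i := ⟨n - 1, by omega⟩) fun j hj => ?_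
  have h := blockMean_le (s := s) j.2
  have hj' : (j : ℕ) + 1 ≠ n := fun h' => hj (Fin.ext (by simp only []; omega))
  rw [coe_lastBest, coe_lastBest, if_neg hj', if_pos (by simp only []; omega)]
  linarith

theorem gapSum_lastBest_le (s : ℕ) {α : ℝ} (hα : 1 ≤ α) :
    (lastBest n s).gapSum α ≤ n * (16 : ℝ) ^ α / 4 := by
  have h4 : ((1 / 4 : ℝ)) ^ (1 - 2 * α) = (16 : ℝ) ^ α / 4 := by
    rw [one_div, Real.inv_rpow (by norm_num), ← Real.rpow_neg (by norm_num), neg_sub,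
      Real.rpow_sub (by norm_num), Real.rpow_mul (by norm_num), Real.rpow_one]
    norm_num
  calc (lastBest n s).gapSum α
      ≤ ∑ i with 0 < (lastBest n s).gap i, ((1 / 4 : ℝ)) ^ (1 - 2 * α) := by
        refine sum_le_sum fun k hk => ?_
        refine Real.rpow_le_rpow_of_nonpos (by norm_num) (quarter_le_gap_lastBest s fun hk' => ?_)
          (by linarith)
        have hb : ∀ j, (lastBest n s j : ℝ) ≤ lastBest n s k := fun j => by
          have h := blockMean_le (s := s) j.2
          rw [coe_lastBest, coe_lastBest, if_pos hk']
          split_ifs <;> linarith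
        have := (mem_filter.1 hk).2
        rw [gap, bestMean_eq hb] at this
        linarith
    _ ≤ n * ((16 : ℝ) ^ α / 4) := by
        rw [sum_const, nsmul_eq_mul, h4]
        refine mul_le_mul_of_nonneg_right ?_ (by positivity)
        exact_mod_cast (card_le_univ _).trans_eq (Fintype.card_fin n)
    _ = _ := by ring

section BlockBest

variable {s : ℕ} {ε : ℝ} {i : Fin n}

theorem blockMean_add_le {k l : ℕ} (h : k / s < l / s) :
    blockMean n s k + 1 / (8 * n) ≤ blockMean n s l := by
  have h : ((k / s : ℕ) : ℝ) + 1 ≤ (l / s : ℕ) := by exact_mod_cast h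
  have := div_le_div_of_nonneg_right h (show (0 : ℝ) ≤ 8 * n by positivity)
  rw [add_div] at this
  unfold blockMean
  linarith

theorem blockMean_congr {k l : ℕ} (h : k / s = l / s) : blockMean n s k = blockMean n s l := by
  rw [blockMean, blockMean, h]

theorem one_div_le_eighth (i : Fin n) : (1 : ℝ) / (8 * n) ≤ 1 / 8 := by
  have hn : (1 : ℝ) ≤ n := by exact_mod_cast (Nat.one_le_iff_ne_zero.2 (by have := i.2; omega))
  exact one_div_le_one_div_of_le (by norm_num) (by linarith)

theorem blockBest_le (hε : 0 ≤ ε) (hε' : ε ≤ 1 / (8 * n)) (k : Fin n) :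
    (blockBest s ε i k : ℝ) ≤ blockBest s ε i i := by
  have hcoe := coe_blockBest s hε (hε'.trans (one_div_le_eighth i)) i
  have h8n : (0 : ℝ) ≤ 1 / (8 * n) := by positivity
  have hhalf := half_le_blockMean n s i
  rw [hcoe k, hcoe i, if_pos rfl]
  split_ifs with h1 h2
  · rw [h1]
  · rcases h2.lt_or_eq with h2 | h2
    · linarith [blockMean_add_le (n := n) h2]
    · linarith [blockMean_congr (n := n) h2]
  · linarith

/-- The steps of `blockMean` serve this dichotomy: only arms in the block of `i` have the small gap
`ε`, while earlier blocks are worse by a full step and later ones have mean `0`. -/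
theorem gap_blockBest (hε : 0 ≤ ε) (hε' : ε ≤ 1 / (8 * n)) {j : Fin n} (hj : j ≠ i) :
    ((j : ℕ) / s = i / s → (blockBest s ε i).gap j = ε) ∧
      ((j : ℕ) / s ≠ i / s → 1 / (8 * n) ≤ (blockBest s ε i).gap j) := by
  have h8n := one_div_le_eighth i
  have hcoe := coe_blockBest s hε (hε'.trans h8n) i
  have hhalf := half_le_blockMean n s i
  rw [gap_eq_of_forall_le (blockBest_le hε hε'), hcoe i, hcoe j, if_pos rfl, if_neg hj]
  refine ⟨fun h => ?_, fun h => ?_⟩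
  · rw [if_pos h.le, blockMean_congr h]
    ring
  · split_ifs with h2
    · linarith [blockMean_add_le (n := n) (lt_of_le_of_ne h2 h)]
    · linarith

theorem le_gap_blockBest (hε : 0 ≤ ε) (hε' : ε ≤ 1 / (8 * n)) {j : Fin n} (hj : j ≠ i) :
    ε ≤ (blockBest s ε i).gap j := by
  obtain ⟨h1, h2⟩ := gap_blockBest (s := s) hε hε' hj
  by_cases h : (j : ℕ) / s = i / s
  · exact (h1 h).ge
  · exact hε'.trans (h2 h)

theorem hasUniqueBestArm_blockBest (hε : 0 < ε) (hε' : ε ≤ 1 / (8 * n)) :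
    (blockBest s ε i).HasUniqueBestArm := by
  refine hasUniqueBestArm_of_lt (i := i) fun j hj => ?_
  have := le_gap_blockBest (s := s) hε.le hε' hj
  rw [gap_eq_of_forall_le (blockBest_le hε.le hε')] at this
  linarith

end BlockBest

/-- The arms of the block with index `b`. -/
def block (n s b : ℕ) : Finset (Fin n) := {k | (k : ℕ) / s = b}

theorem card_block {s b : ℕ} (hs : 0 < s) (hb : (b + 1) * s ≤ n) : #(block n s b) = s := by
  have h : (block n s b).map Fin.valEmbedding = Ico (b * s) ((b + 1) * s) := by
    ext k
    simp only [block, mem_map, mem_filter, mem_univ, true_and, Fin.valEmbedding_apply, mem_Ico]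
    constructor
    · rintro ⟨j, rfl, rfl⟩
      exact ⟨Nat.div_mul_le_self j s, (Nat.div_lt_iff_lt_mul hs).1 (Nat.lt_succ_self _)⟩
    · intro hk
      exact ⟨⟨k, by omega⟩, by rw [Nat.div_eq_of_lt_le hk.1 hk.2], rfl⟩
  rw [← card_map, h, Nat.card_Ico, Nat.succ_mul, Nat.add_sub_cancel_left]

/-- Each arm outside the block has gap at least `n * ε`, hence contributes at most `ε ^ (1 - 2 * α)
/ n`; all of them together count no more than one arm of the block. -/
theorem gapSum_blockBest_le {s : ℕ} {ε : ℝ} {i : Fin n} (hs : #(block n s (i / s)) = s)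
    (hs1 : 1 ≤ s) (hε : 0 < ε) (hε' : n * ε ≤ 1 / (8 * n)) {α : ℝ} (hα : 1 ≤ α) :
    (blockBest s ε i).gapSum α ≤ 2 * s * ε ^ (1 - 2 * α) := by
  have hn : (1 : ℝ) ≤ n := by exact_mod_cast (Nat.one_le_iff_ne_zero.2 (by have := i.2; omega))
  have hε1 : ε ≤ 1 / (8 * n) := le_trans (by nlinarith) hε'
  have hp : 0 < ε ^ (1 - 2 * α) := Real.rpow_pos_of_pos hε _
  set ν := blockBest s ε i
  have hself : ∀ k, 0 < ν.gap k → k ≠ i := by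
    rintro k hk rfl
    rw [gap_eq_of_forall_le (blockBest_le hε.le hε1), sub_self] at hk
    exact hk.false
  have h1 : ∀ k ∈ ({k | 0 < ν.gap k} : Finset (Fin n)), ν.gap k ^ (1 - 2 * α)
      ≤ (if k ∈ block n s (i / s) then ε ^ (1 - 2 * α) else 0) + ε ^ (1 - 2 * α) / n := by
    intro k hk
    have hki := hself k (mem_filter.1 hk).2
    obtain ⟨h2, h3⟩ := gap_blockBest (s := s) hε.le hε1 hki
    have hdiv : 0 < ε ^ (1 - 2 * α) / n := by positivity
    by_cases h : (k : ℕ) / s = i / s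
    · rw [h2 h, if_pos (by simp [block, h])]
      linarith
    · rw [if_neg (by simp [block, h]), zero_add]
      calc ν.gap k ^ (1 - 2 * α) ≤ (n * ε) ^ (1 - 2 * α) :=
            Real.rpow_le_rpow_of_nonpos (by positivity) (hε'.trans (h3 h)) (by linarith)
        _ = (n : ℝ) ^ (1 - 2 * α) * ε ^ (1 - 2 * α) := Real.mul_rpow (by positivity) hε.le
        -- This uses `1 - 2 * α ≤ -1`.
        _ ≤ (n : ℝ) ^ (-1 : ℝ) * ε ^ (1 - 2 * α) := mul_le_mul_of_nonneg_right
            (Real.rpow_le_rpow_of_exponent_le hn (by linarith)) hp.le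
        _ = ε ^ (1 - 2 * α) / n := by rw [Real.rpow_neg_one]; ring
  calc ν.gapSum α ≤ ∑ k with 0 < ν.gap k,
        ((if k ∈ block n s (i / s) then ε ^ (1 - 2 * α) else 0) + ε ^ (1 - 2 * α) / n) :=
        sum_le_sum h1
    _ ≤ ∑ k, ((if k ∈ block n s (i / s) then ε ^ (1 - 2 * α) else 0) + ε ^ (1 - 2 * α) / n) :=
        sum_le_sum_of_subset_of_nonneg (filter_subset _ _) fun k _ _ => by
          split_ifs <;> positivity
    _ = (s + 1) * ε ^ (1 - 2 * α) := by
        rw [sum_add_distrib, sum_ite_mem, univ_inter, sum_const, hs, sum_const, card_univ,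
          Fintype.card_fin, nsmul_eq_mul, nsmul_eq_mul]
        field_simp
    _ ≤ _ := by
        have : (1 : ℝ) ≤ s := by exact_mod_cast hs1
        exact mul_le_mul_of_nonneg_right (by linarith) hp.le

end BanditInstance

/-! ### The dichotomy between the two kinds of instance. -/

-- `W` is the regret scale. `h1` makes the pulls in an average block too few to detect `ε`, `h2`
-- makes the loss on `blockBest` exceed the target, and `h3` makes regret below target on `lastBest`
-- at most `T / 24`.
open StreamHistory BanditInstance in
theorem StreamingAlgorithm.le_expectedRegret_lastBest_or {m n s B T : ℕ} {α W ε c : ℝ}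
    (A : StreamingAlgorithm n m) (hα : 1 ≤ α) (hm : 1 ≤ m) (hms : m ≤ s) (hB : 1 ≤ B)
    (hsB : B * s + 1 ≤ n) (hT : 2 ≤ T) (hc : 0 < c) (hW : 0 ≤ W) (hε : 0 < ε)
    (hε' : n * ε ≤ 1 / (8 * n)) (h1 : 48 * c * ε ^ 2 * W * n ≤ B * ((s : ℝ) + 1 - m))
    (h2 : 32 * c * s ^ 2 * (16 : ℝ) ^ (-α) * W * ε ^ (1 - 2 * α) ≤ ε * T * ((s : ℝ) + 1 - m))
    (h3 : 6 * c * W * n ≤ T) :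
    c * ((16 : ℝ) ^ (-α) * W * (lastBest n s).gapSum α) ≤ A.expectedRegret (lastBest n s) T ∨
      ∃ i : Fin n, (i : ℕ) / s < B ∧ c * ((16 : ℝ) ^ (-α) * W * (blockBest s ε i).gapSum α)
        ≤ A.expectedRegret (blockBest s ε i) T := by
  have hn1 : (1 : ℝ) ≤ n := by exact_mod_cast (by omega : 1 ≤ n)
  have hε1 : ε ≤ 1 / (8 * n) := le_trans (by nlinarith) hε'
  have hε8 : ε ≤ 1 / 8 := hε1.trans (one_div_le_eighth ⟨0, by omega⟩)
  have hs : 0 < s := by omega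
  have h16 : (0 : ℝ) < (16 : ℝ) ^ (-α) := by positivity
  rw [or_iff_not_imp_left, not_le]
  intro hR
  have hR' : A.expectedRegret (lastBest n s) T ≤ c * W * n / 4 := by
    refine hR.le.trans ?_
    have := mul_le_mul_of_nonneg_left (gapSum_lastBest_le (n := n) s hα)
      (show 0 ≤ c * ((16 : ℝ) ^ (-α) * W) by positivity)
    have h16' : (16 : ℝ) ^ (-α) * (16 : ℝ) ^ α = 1 := by
      rw [← Real.rpow_add (by norm_num), neg_add_cancel, Real.rpow_zero]
    calc _ = c * ((16 : ℝ) ^ (-α) * W) * (lastBest n s).gapSum α := by ring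
      _ ≤ _ := this
      _ = c * W * n / 4 * ((16 : ℝ) ^ (-α) * (16 : ℝ) ^ α) := by ring
      _ = _ := by rw [h16', mul_one]
  have hlast : ∀ {b : ℕ}, b ≤ B → ∀ k : Fin n, (k : ℕ) < b * s → (k : ℕ) + 1 ≠ n :=
    fun hb k hk => by
      have := Nat.mul_le_mul_right s hb
      omega
  have hpulls : ∑ b ∈ range B, ∑ i ∈ block n s b, A.expect (lastBest n s) (T / 2) (pulls i)
      ≤ c * W * n := by
    have h4 : ∑ b ∈ range B, ∑ i ∈ block n s b, A.expect (lastBest n s) (T / 2) (pulls i)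
        = ∑ i with i.val / s < B, A.expect (lastBest n s) (T / 2) (pulls i) := by
      rw [← sum_fiberwise_of_maps_to (t := range B) (g := fun i : Fin n => i.val / s)
        fun i hi => mem_range.2 (mem_filter.1 hi).2]
      refine sum_congr rfl fun b hb => sum_congr ?_ fun _ _ => rfl
      ext k
      simp only [block, mem_filter, mem_univ, true_and]
      exact ⟨fun h => ⟨h ▸ mem_range.1 hb, h⟩, fun h => h.2⟩
    rw [h4, ← expect_sum]
    have h5 := expect_mono (A := A) (ν := lastBest n s) (t := T / 2) fun h _ _ =>
      sum_pulls_le_regret (lastBest n s) (U := {i : Fin n | i.val / s < B}) (fun i hi =>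
        quarter_le_gap_lastBest s (hlast le_rfl i
          ((Nat.div_lt_iff_lt_mul hs).1 (mem_filter.1 hi).2))) h
    rw [expect_const_mul] at h5
    have h6 := expect_regret_le (A := A) (ν := lastBest n s) (Nat.div_le_self T 2)
    linarith
  -- Pigeonhole: some block gets at most the average number of pulls.
  obtain ⟨b, hb, hbp⟩ := exists_le_of_sum_le (s := range B) (nonempty_range_iff.2 (by omega))
    (g := fun _ => c * W * n / B) (hpulls.trans_eq (by
      have : (B : ℝ) ≠ 0 := by exact_mod_cast (by omega : B ≠ 0)
      rw [sum_const, card_range, nsmul_eq_mul, mul_div_cancel₀ _ this]))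
  rw [mem_range] at hb
  have hbs : (b + 1) * s ≤ B * s := Nat.mul_le_mul_right s hb
  have hcard : #(block n s b) = s := card_block hs (by omega)
  have hmem : ∀ i ∈ block n s b, (i : ℕ) / s = b := fun i hi => (mem_filter.1 hi).2
  obtain ⟨i, hi, h⟩ := A.exists_le_expectedRegret (ν := lastBest n s) (e := (b + 1) * s)
    (S := block n s b) (ν' := blockBest s ε) (b := blockMean n s (b * s)) (ε := ε) (T := T)
    (fun i hi => (Nat.div_lt_iff_lt_mul hs).1 (by rw [hmem i hi]; omega))
    (fun k hk => quarter_le_gap_lastBest s (hlast hb k hk)) (by omega)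
    (fun i hi j hj hji => by
      refine Subtype.ext ?_
      have hjb := (Nat.div_lt_iff_lt_mul hs).2 hj
      rw [coe_lastBest, coe_blockBest s hε.le hε8, if_neg (hlast hb j hj), if_neg hji,
        if_pos (by rw [hmem i hi]; omega)])
    (half_le_blockMean _ _ _) hε.le
    (by linarith [blockMean_le (n := n) (s := s) (k := b * s) (by rw [Nat.succ_mul] at hbs; omega)])
    (fun i hi => by
      have hib : (i : ℕ) < (b + 1) * s := (Nat.div_lt_iff_lt_mul hs).1 (by rw [hmem i hi]; omega)
      rw [coe_lastBest, if_neg (hlast hb i hib)]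
      exact blockMean_congr (by rw [hmem i hi, Nat.mul_div_cancel _ hs]))
    (fun i hi => by
      have : blockMean n s i = blockMean n s (b * s) :=
        blockMean_congr (by rw [hmem i hi, Nat.mul_div_cancel _ hs])
      rw [coe_blockBest s hε.le hε8, if_pos rfl, this])
    (fun i _ j hj => le_gap_blockBest hε.le hε1 hj) hT (by linarith) (by
      rw [hcard]
      have hB0 : (0 : ℝ) < B := by exact_mod_cast hB
      refine le_trans (mul_le_mul_of_nonneg_left hbp (by positivity)) ?_
      rw [mul_div_assoc', div_le_iff₀ hB0]
      linarith)
  refine ⟨i, by rw [hmem i hi]; exact hb, ?_⟩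
  rw [hcard] at h
  have h7 := mul_le_mul_of_nonneg_left
    (gapSum_blockBest_le (i := i) (by rw [hmem i hi, hcard]) hs hε hε' hα)
    (show 0 ≤ 16 * s * (c * ((16 : ℝ) ^ (-α) * W)) by positivity)
  have hs0 : (0 : ℝ) < 16 * s := by exact_mod_cast (by omega : 0 < 16 * s)
  refine le_of_mul_le_mul_left ?_ hs0
  linarith

open BanditInstance in
/-- The lower bound for arms divided into `B` blocks of length `s`. -/
theorem exists_finset_le_expectedRegret {m n s B T : ℕ} {α M w c : ℝ} (hα : 1 ≤ α) (hm : 1 ≤ m)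
    (hms : m ≤ s) (hB : 1 ≤ B) (hsB : B * s + 1 ≤ n) (hc : 0 < c) (hc' : c ≤ 1 / 6) (hw : 0 ≤ w)
    (hw' : w ≤ 1) (hM : 1 ≤ M) (hMn : M ≤ n) (h1 : 3 * c * w * n ≤ B * ((s : ℝ) + 1 - m))
    (h2 : 32 * c * s ^ 2 * w ≤ M * ((s : ℝ) + 1 - m))
    (hT : n * (4 * (n : ℝ) ^ 4) ^ (α + 1) ≤ T) :
    ∃ H : Finset (BanditInstance n), (∀ ν ∈ H, (∃ i, 0 < ν.gap i) ∧ ν.HasUniqueBestArm) ∧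
      ∀ A : StreamingAlgorithm n m, ∃ ν ∈ H,
        c * ((16 : ℝ) ^ (-α) * (w * (T / M) ^ (1 / (α + 1))) * ν.gapSum α)
          ≤ A.expectedRegret ν T := by
  classical
  have hn2 : 2 ≤ n := by
    have := Nat.mul_le_mul hB (hm.trans hms)
    omega
  have hn : (2 : ℝ) ≤ n := by exact_mod_cast hn2
  have hn4 : (n : ℝ) ≤ 4 * (n : ℝ) ^ 4 := by nlinarith [pow_le_pow_left₀ zero_le_two hn 3]
  have hT0 : (0 : ℝ) < T := lt_of_lt_of_le (by positivity) hT
  have hM0 : 0 < M := by linarith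
  -- The lower bound on `T` gives `N ≥ 4 * n ^ 4`, so that `√N ≥ 2 * n ^ 2` and `ε = 1 / (4 * √N)`
  -- satisfies `n * ε ≤ 1 / (8 * n)`.
  obtain ⟨N, hN⟩ : ∃ N, N = ((T : ℝ) / M) ^ (1 / (α + 1)) := ⟨_, rfl⟩
  have hNT : N ^ (α + 1) = T / M := by
    rw [hN, ← Real.rpow_mul (by positivity), one_div_mul_cancel (by linarith), Real.rpow_one]
  have hN4 : 4 * (n : ℝ) ^ 4 ≤ N := by
    rw [hN, one_div, Real.le_rpow_inv_iff_of_pos (by positivity) (by positivity) (by linarith),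
      le_div_iff₀ hM0]
    refine le_trans ?_ hT
    rw [mul_comm]
    exact mul_le_mul_of_nonneg_right hMn (by positivity)
  have hN0 : 0 < N := by linarith
  have hNN : N * N ≤ T := by
    calc N * N = N ^ (2 : ℝ) := by rw [Real.rpow_two, sq]
      _ ≤ N ^ (α + 1) := Real.rpow_le_rpow_of_exponent_le (by linarith) (by linarith)
      _ ≤ T := by rw [hNT]; exact div_le_self hT0.le hM
  obtain ⟨ε, hεdef⟩ : ∃ ε, ε = 1 / (4 * √N) := ⟨_, rfl⟩
  have hsq : 0 < √N := Real.sqrt_pos.2 hN0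
  have hε : 0 < ε := by rw [hεdef]; positivity
  have hε2 : ε ^ 2 = (16 * N)⁻¹ := by
    rw [hεdef, div_pow, mul_pow, Real.sq_sqrt hN0.le]
    norm_num
  have hε' : n * ε ≤ 1 / (8 * n) := by
    have : 2 * (n : ℝ) ^ 2 ≤ √N := Real.le_sqrt_of_sq_le (by linarith [hN4])
    rw [hεdef, mul_one_div, div_le_div_iff₀ (by positivity) (by positivity)]
    linarith
  have hε1 : ε ≤ 1 / (8 * n) := le_trans (by nlinarith) hε'
  -- The factor `16 ^ (-α)` absorbs the `16` in `ε ^ 2 = (16 * N)⁻¹`; on `lastBest` it absorbs the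
  -- gap `1/4`.
  have hεα : (16 : ℝ) ^ (-α) * ε ^ (1 - 2 * α) = ε * N ^ α := by
    have h16 : (16 : ℝ) ^ (-α) * (16 : ℝ) ^ α = 1 := by
      rw [← Real.rpow_add (by norm_num), neg_add_cancel, Real.rpow_zero]
    rw [sub_eq_add_neg, Real.rpow_add hε, Real.rpow_one, ← mul_neg, Real.rpow_mul hε.le,
      Real.rpow_two, hε2, Real.inv_rpow (by positivity), ← Real.rpow_neg (by positivity), neg_neg,
      Real.mul_rpow (by norm_num) hN0.le]
    linear_combination ε * N ^ α * h16
  refine ⟨insert (lastBest n s) (({i | i.val / s < B} : Finset (Fin n)).image (blockBest s ε)),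
    fun ν hν => ?_, fun A => ?_⟩
  · rw [mem_insert, mem_image] at hν
    rcases hν with rfl | ⟨i, -, rfl⟩
    · refine ⟨⟨⟨0, by omega⟩, ?_⟩, hasUniqueBestArm_lastBest s (by omega)⟩
      exact lt_of_lt_of_le (by norm_num) (quarter_le_gap_lastBest s (by simp only []; omega))
    · have : Nontrivial (Fin n) := Fin.nontrivial_iff_two_le.2 hn2
      obtain ⟨j, hj⟩ := exists_ne i
      exact ⟨⟨j, hε.trans_le (le_gap_blockBest hε.le hε1 hj)⟩, hasUniqueBestArm_blockBest hε hε1⟩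
  · rw [← hN]
    have hT2 : 2 ≤ T := by
      have : (2 : ℝ) ≤ T := by nlinarith
      exact_mod_cast this
    rcases A.le_expectedRegret_lastBest_or (W := w * N) (c := c) hα hm hms hB hsB hT2 hc
      (by positivity) hε hε' (by
        rw [hε2]
        calc 48 * c * (16 * N)⁻¹ * (w * N) * n = 3 * c * w * n := by
              field_simp
              ring
          _ ≤ _ := h1) (by
        have h3 : N ^ α * N = T / M := by rw [← hNT, Real.rpow_add hN0, Real.rpow_one]
        calc 32 * c * s ^ 2 * (16 : ℝ) ^ (-α) * (w * N) * ε ^ (1 - 2 * α)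
            = 32 * c * s ^ 2 * w * N * ((16 : ℝ) ^ (-α) * ε ^ (1 - 2 * α)) := by ring
          _ = 32 * c * s ^ 2 * w * (ε * (N ^ α * N)) := by rw [hεα]; ring
          _ ≤ M * ((s : ℝ) + 1 - m) * (ε * (T / M)) := by
              rw [h3]
              exact mul_le_mul_of_nonneg_right h2 (by positivity)
          _ = ε * T * ((s : ℝ) + 1 - m) := by
              field_simp) (by
        have h4 : c * w ≤ 1 / 6 := by nlinarith
        have h5 : (n : ℝ) * N ≤ T := by nlinarith
        have h6 := mul_le_mul_of_nonneg_right h4 (show 0 ≤ (n : ℝ) * N by positivity)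
        linarith) with h | ⟨i, hi, h⟩
    · exact ⟨_, mem_insert_self _ _, h⟩
    · exact ⟨_, mem_insert_of_mem (mem_image_of_mem _ (mem_filter.2 ⟨mem_univ i, hi⟩)), h⟩

end

/-! ### Choice of block length and number of blocks. -/

theorem mainTheorem4 :
    ∃ c : ℝ, 0 < c ∧ ∀ α : ℝ, 1 ≤ α → ∀ m n : ℕ, 2 ≤ m → m < n →
      ∃ T₀ : ℕ, ∀ T : ℕ, T₀ ≤ T →
        ∃ H : Finset (BanditInstance n),
          (∀ ν ∈ H, (∃ i, 0 < ν.gap i) ∧ ((2 / 3 : ℝ) * n ≤ m → ν.HasUniqueBestArm)) ∧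
          ∀ A : StreamingAlgorithm n m, ∃ ν ∈ H,
            ((m : ℝ) < (2 / 3 : ℝ) * n →
              c * ((16 : ℝ) ^ (-α) *
                ((T : ℝ) ^ (1 / (α + 1)) / (m : ℝ) ^ (1 / (α + 1))) * ν.gapSum α)
                ≤ A.expectedRegret ν T) ∧
            ((2 / 3 : ℝ) * n ≤ m →
              c * ((16 : ℝ) ^ (-α) *
                (((n : ℝ) - m) * (T : ℝ) ^ (1 / (α + 1)) / (n : ℝ) ^ (1 + 1 / (α + 1))) *
                  ν.gapSum α)
                ≤ A.expectedRegret ν T) := by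
  refine ⟨1 / 200, by norm_num, fun α hα m n hm hmn => ?_⟩
  refine ⟨⌈(n : ℝ) * (4 * (n : ℝ) ^ 4) ^ (α + 1)⌉₊, fun T hT => ?_⟩
  replace hT := Nat.ceil_le.1 hT
  have hm2 : (2 : ℝ) ≤ m := by exact_mod_cast hm
  have hmn1 : (m : ℝ) + 1 ≤ n := by exact_mod_cast hmn
  have hT0 : (0 : ℝ) ≤ T := T.cast_nonneg
  rcases lt_or_ge (m : ℝ) ((2 / 3 : ℝ) * n) with hcase | hcase
  · obtain ⟨s, B, hms, hB, hsB, h1, h2⟩ : ∃ s B : ℕ, m ≤ s ∧ 1 ≤ B ∧ B * s + 1 ≤ n ∧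
        3 * (1 / 200) * 1 * (n : ℝ) ≤ B * ((s : ℝ) + 1 - m) ∧
        32 * (1 / 200) * (s : ℝ) ^ 2 * 1 ≤ m * ((s : ℝ) + 1 - m) := by
      -- If blocks of length `2 * m` fit before the last arm, each loses at least `m + 1` arms and
      -- their number is of order `n / m`. Otherwise a single block of `n - 1` arms suffices, since
      -- `n - m` is then comparable to `n`.
      rcases Nat.lt_or_ge (2 * m) n with h | h
      · have h3 := Nat.div_mul_le_self (n - 1) (2 * m)
        have h4 : n ≤ ((n - 1) / (2 * m) + 1) * (2 * m) := by
          have := (Nat.div_lt_iff_lt_mul (by omega : 0 < 2 * m)).1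
            (Nat.lt_succ_self ((n - 1) / (2 * m)))
          rw [Nat.succ_eq_add_one] at this
          omega
        have h5 : 1 ≤ (n - 1) / (2 * m) := (Nat.le_div_iff_mul_le (by omega)).2 (by omega)
        refine ⟨2 * m, (n - 1) / (2 * m), by omega, h5, by omega, ?_, ?_⟩
        · generalize (n - 1) / (2 * m) = B at h4 h5
          have h4 : (n : ℝ) ≤ (B + 1) * (2 * m) := by exact_mod_cast h4
          have h5 : (1 : ℝ) ≤ B := by exact_mod_cast h5
          push_cast
          nlinarith
        · push_cast
          nlinarith
      · refine ⟨n - 1, 1, by omega, le_rfl, by omega, ?_, ?_⟩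
        · rw [Nat.cast_sub (by omega)]
          push_cast
          linarith
        · have h : (n : ℝ) ≤ 2 * m := by exact_mod_cast h
          rw [Nat.cast_sub (by omega)]
          push_cast
          nlinarith
    obtain ⟨H, hH, h⟩ := exists_finset_le_expectedRegret (M := m) (w := 1) (c := 1 / 200) hα
      (by omega) hms hB hsB (by norm_num) (by norm_num) zero_le_one le_rfl (by linarith)
      (by linarith) h1 h2 hT
    refine ⟨H, fun ν hν => ⟨(hH ν hν).1, fun _ => (hH ν hν).2⟩, fun A => ?_⟩
    obtain ⟨ν, hν, hle⟩ := h A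
    refine ⟨ν, hν, fun _ => ?_, fun h => (h.not_gt hcase).elim⟩
    rwa [one_mul, Real.div_rpow hT0 (by linarith)] at hle
  · have hn0 : (0 : ℝ) < n := by linarith
    have hs : ((n - 1 : ℕ) : ℝ) = n - 1 := by rw [Nat.cast_sub (by omega), Nat.cast_one]
    -- With one block, `s + 1 - m = n - m` may be much smaller than `n`. The weight `w = (n - m) /
    -- n` puts the same factor on the other side of both numerical conditions.
    obtain ⟨H, hH, h⟩ := exists_finset_le_expectedRegret (m := m) (s := n - 1) (B := 1) (M := n)
      (w := ((n : ℝ) - m) / n) (c := 1 / 200) hα (by omega) (by omega) le_rfl (by omega)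
      (by norm_num) (by norm_num) (div_nonneg (by linarith) hn0.le)
      ((div_le_one hn0).2 (by linarith)) (by linarith) le_rfl
      (by
        rw [mul_assoc, div_mul_cancel₀ _ hn0.ne', hs]
        push_cast
        linarith)
      (by
        rw [hs, mul_div_assoc', div_le_iff₀ hn0]
        have h1 : ((n : ℝ) - 1) ^ 2 ≤ n ^ 2 := pow_le_pow_left₀ (by linarith) (by linarith) 2
        have h2 := mul_le_mul_of_nonneg_right h1 (show (0 : ℝ) ≤ n - m by linarith)
        nlinarith [mul_nonneg (sq_nonneg (n : ℝ)) (show (0 : ℝ) ≤ n - m by linarith)]) hT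
    refine ⟨H, fun ν hν => ⟨(hH ν hν).1, fun _ => (hH ν hν).2⟩, fun A => ?_⟩
    obtain ⟨ν, hν, hle⟩ := h A
    refine ⟨ν, hν, fun h => (hcase.not_gt h).elim, fun _ => ?_⟩
    rw [Real.div_rpow hT0 hn0.le] at hle
    rw [Real.rpow_add hn0, Real.rpow_one, mul_div_mul_comm]
    exact hle
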